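/- Conventions. For an integer matrix $A$ let $\|A\|_\infty$ be the largest absolute value of an entry. The primal graph $G_P(A)$ has the columns of $A$ as vertices, two distinct columns being adjacent if some row is non-zero in both; the dual graph is $G_D(A)=G_P(A^{\mathsf T})$. The height of a finite rooted forest is the maximum number of vertices on a root-leaf path, and its closure is the graph in which every vertex is adjacent to all of its ancestors. A td-decomposition of a graph $G$ is a finite rooted forest $F$ (for instance a rooted tree) such that $G$ is a subgraph of the closure of $F$; the treedepth $\operatorname{td}(G)$ is the minimum height of a td-decomposition of $G$ on the vertex set $V(G)$; $\operatorname{td}_P(A)=\operatorname{td}(G_P(A))$ and $\operatorname{td}_D(A)=\operatorname{td}(G_D(A))$. Denominators are those of fractions in lowest terms. Theorem. (1) There is a computable function $f:\mathbb N^2\to\mathbb N$ such that for every integer matrix $A\in\mathbb Z^{m\times n}$, every td-decomposition $F$ of $G_P(A)$ and every invertible $m\times m$ submatrix $A_B$ formed by columns of $A$, every entry of $A_B^{-1}$ has denominator at most $f(\|A\|_\infty,\operatorname{height}(F))$. (2) There is a computable function $g:\mathbb N^2\to\mathbb N$ such that every feasible mixed integer linear program $$\min\{\,c\,x \;:\;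 Ax=b,\ l\le x\le u,\ x\in\mathbb Z^{z}\times\mathbb Q^{q}\,\},\qquad A\in\mathbb Z^{m\times(z+q)},\ l,u,c\in\mathbb Z^{z+q},\ b\in\mathbb Z^m,$$ has an optimal solution $x$ all of whose entries have denominator at most $g\bigl(\|A\|_\infty,\min\{\operatorname{td}_P(A),\operatorname{td}_D(A)\}\bigr)$. -/

import Mathlib

namespace TDMILP

/-- The primal graph of an integer matrix: the vertices are the columns, and two distinct columns
are adjacent if some row is non-zero in both of them. -/
def primalGraph {ι κ : Type} (A : Matrix ι κ ℤ) : SimpleGraph κ where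
  Adj i j := i ≠ j ∧ ∃ k, A k i ≠ 0 ∧ A k j ≠ 0
  symm := ⟨fun _ _ h => ⟨h.1.symm, h.2.imp fun _ hk => ⟨hk.2, hk.1⟩⟩⟩
  loopless := ⟨fun _ h => h.1 rfl⟩

/-- The dual graph of a matrix is the primal graph of its transpose. -/
def dualGraph {ι κ : Type} (A : Matrix ι κ ℤ) : SimpleGraph ι :=
  primalGraph A.transpose

/-- A rooted forest on the vertex set `T`, given by its ancestor relation: `anc u v` means that `u`
is an ancestor of `v` or `u = v`. It is a partial order, and the ancestors of a vertex form a chain.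
(On a finite set the parent of `v` is its nearest proper ancestor, and the roots are the vertices
without proper ancestors. A rooted tree is the case of a single root.) -/
structure RootedForest (T : Type) where
  anc : T → T → Prop
  anc_refl : ∀ u, anc u u
  anc_trans : ∀ u v w, anc u v → anc v w → anc u w
  anc_antisymm : ∀ u v, anc u v → anc v u → u = v
  anc_chain : ∀ u v w, anc u w → anc v w → anc u v ∨ anc v u

namespace RootedForest

variable {T V : Type}

/-- The closure of a rooted forest: every vertex is made adjacent to all of its ancestors. -/
def closure (F : RootedForest T) : SimpleGraph T where
  Adj u v := u ≠ v ∧ (F.anc u v ∨ F.anc v u)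
  symm := ⟨fun _ _ h => ⟨h.1.symm, h.2.symm⟩⟩
  loopless := ⟨fun _ h => h.1 rfl⟩

/-- The number of vertices on the path from a root to `v`, both ends included. -/
noncomputable def depth (F : RootedForest T) (v : T) : ℕ :=
  {u : T | F.anc u v}.ncard

/-- The height of a finite rooted forest: the maximum number of vertices on a root-leaf path.
(The maximum of `depth` over all vertices is attained at a leaf.) It is `0` for the empty forest. -/
noncomputable def height [Fintype T] (F : RootedForest T) : ℕ :=
  Finset.univ.sup F.depth

/-- `F` is a td-decomposition of `G` if `G` is a subgraph of the closure of `F`, after an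
identification of the vertices of `G` with (some) vertices of `F`. -/
def IsTdDecomposition (F : RootedForest T) (G : SimpleGraph V) : Prop :=
  G.IsContained F.closure

end RootedForest

/-- The treedepth of a finite graph: the minimum height of a rooted forest on its vertex set that
is a td-decomposition. -/
noncomputable def treedepth {V : Type} [Fintype V] (G : SimpleGraph V) : ℕ :=
  sInf {h : ℕ | ∃ F : RootedForest V, F.IsTdDecomposition G ∧ F.height = h}

/-- The largest absolute value of an entry of an integer matrix. -/
def maxCoeff {ι κ : Type} [Fintype ι] [Fintype κ] (A : Matrix ι κ ℤ) : ℕ :=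
  Finset.univ.sup fun p : ι × κ => (A p.1 p.2).natAbs

/-- The largest denominator of an entry, in lowest terms, of a rational vector. -/
def vecFr {κ : Type} [Fintype κ] (x : κ → ℚ) : ℕ :=
  Finset.univ.sup fun j => (x j).den

/-- The fractionality of a rational matrix: the largest denominator of an entry in lowest terms. -/
def fr {ι κ : Type} [Fintype ι] [Fintype κ] (M : Matrix ι κ ℚ) : ℕ :=
  Finset.univ.sup fun p : ι × κ => (M p.1 p.2).den

/-- An instance of mixed integer linear programming with `m` equations, `z` integer variables
and `q` rational variables,
`min {c x ∣ A x = b, l ≤ x ≤ u, x ∈ ℤ^z × ℚ^q}`, with integer data. -/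
structure MILP (m z q : ℕ) where
  A : Matrix (Fin m) (Fin z ⊕ Fin q) ℤ
  b : Fin m → ℤ
  c : Fin z ⊕ Fin q → ℤ
  l : Fin z ⊕ Fin q → ℤ
  u : Fin z ⊕ Fin q → ℤ

namespace MILP

variable {m z q : ℕ}

/-- The feasible solutions of an instance. -/
def IsFeasible (I : MILP m z q) (x : Fin z ⊕ Fin q → ℚ) : Prop :=
  (∀ k, ∑ j, (I.A k j : ℚ) * x j = (I.b k : ℚ)) ∧
  (∀ j, (I.l j : ℚ) ≤ x j ∧ x j ≤ (I.u j : ℚ)) ∧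
  (∀ i : Fin z, ∃ t : ℤ, x (Sum.inl i) = (t : ℚ))

/-- The objective value of a point. -/
def objective (I : MILP m z q) (x : Fin z ⊕ Fin q → ℚ) : ℚ :=
  ∑ j, (I.c j : ℚ) * x j

/-- The optimal solutions of an instance. -/
def IsOptimal (I : MILP m z q) (x : Fin z ⊕ Fin q → ℚ) : Prop :=
  I.IsFeasible x ∧ ∀ y, I.IsFeasible y → I.objective x ≤ I.objective y

end MILP

end TDMILP

namespace TDMILP

open Finset

set_option linter.unusedSectionVars false

/-! ### Blocks of a matrix and extension by zero -/

section Block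

variable {ρ ι : Type} [Fintype ι] [DecidableEq ι]

/-! Cramer's rule on a whole matrix gives a denominator depending on its size. Treedepth allows
Cramer's rule to be applied to blocks of bounded size instead. Let `M` be square and non-singular
with every row supported on a root path of a forest `F`. By independence, every set of columns meets
at least as many rows as it has elements; call it tight in case of equality. Whole trees of `F` are
tight, and tight sets are closed under union. Remove from a tight subtree at `t` all tight subtrees
strictly below `t`. What remains, the core of `t`, gives a square non-singular block on the rows
that avoid the removed columns. Each core vertex other than `t` roots a subtree with a surplus row,
and counting these rows bounds the core by a function of the height alone (`card_core_le`).

If `M x` is integral, a row of the core block involves, outside the core, only proper ancestors of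
`t`. Induction on depth therefore costs one bounded determinant per level
(`depth_pow_mul_mem_ratInt`). Taking for `x` the columns of the inverse proves (1). The dual case
follows by transposing the inverse.

For (2), every feasible point is dominated by a basic one, whose free coordinates solve a system
with independent columns and integral right-hand side. Such points have a bounded common
denominator, so they lie in a finite set, and the minimum over that set is a global optimum. -/

/-- The block of `M` on the rows `P` and the columns `S`, over `ℚ`. -/
def ratBlock (M : Matrix ρ ι ℤ) (P : Finset ρ) (S : Finset ι) : Matrix P S ℚ :=
  Matrix.of fun k j => (M k j : ℚ)

/-- Extension of a vector by zero outside of `S`. -/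
def extendZero (S : Finset ι) (y : S → ℚ) (j : ι) : ℚ :=
  if h : j ∈ S then y ⟨j, h⟩ else 0

theorem sum_mul_extendZero (S : Finset ι) (y : S → ℚ) (a : ι → ℚ) :
    ∑ j, a j * extendZero S y j = ∑ j : S, a j * y j := by
  rw [← sum_subset (subset_univ S) (fun j _ hj => by simp [extendZero, hj]), ← sum_coe_sort S]
  exact sum_congr rfl fun j _ => by simp [extendZero]

theorem ratBlock_mulVec (M : Matrix ρ ι ℤ) (P : Finset ρ) (S : Finset ι) (y : S → ℚ) (k : P) :
    (ratBlock M P S).mulVec y k = ∑ j, (M k j : ℚ) * extendZero S y j := by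
  rw [sum_mul_extendZero S y fun j => (M k j : ℚ)]
  rfl

end Block

/-! ### Tight sets of columns -/

section Support

variable {ρ ι : Type} [Fintype ρ]

open Classical in
/-- The rows of `M` that are non-zero in some column of `S`. -/
noncomputable def rowsMeeting (M : Matrix ρ ι ℤ) (S : Finset ι) : Finset ρ :=
  univ.filter fun k => ∃ j ∈ S, M k j ≠ 0

theorem mem_rowsMeeting {M : Matrix ρ ι ℤ} {S : Finset ι} {k : ρ} :
    k ∈ rowsMeeting M S ↔ ∃ j ∈ S, M k j ≠ 0 := by
  simp [rowsMeeting]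

variable [Fintype ι] [DecidableEq ρ] [DecidableEq ι]

/-- The columns of `M` are linearly independent over `ℚ`. -/
def ColIndep (M : Matrix ρ ι ℤ) : Prop :=
  ∀ y : ι → ℚ, (∀ k, ∑ j, (M k j : ℚ) * y j = 0) → ∀ j, y j = 0

theorem rowsMeeting_mono (M : Matrix ρ ι ℤ) {S S' : Finset ι} (h : S ⊆ S') :
    rowsMeeting M S ⊆ rowsMeeting M S' := by
  intro k hk
  rw [mem_rowsMeeting] at hk ⊢
  obtain ⟨j, hj, hk⟩ := hk
  exact ⟨j, h hj, hk⟩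

theorem rowsMeeting_union (M : Matrix ρ ι ℤ) (S S' : Finset ι) :
    rowsMeeting M (S ∪ S') = rowsMeeting M S ∪ rowsMeeting M S' := by
  ext k
  simp only [mem_rowsMeeting, mem_union, or_and_right, exists_or]

theorem rowsMeeting_biUnion {α : Type} (M : Matrix ρ ι ℤ) (L : Finset α) (S : α → Finset ι) :
    rowsMeeting M (L.biUnion S) = L.biUnion fun v => rowsMeeting M (S v) := by
  ext k
  simp only [mem_rowsMeeting, mem_biUnion]
  constructor
  · rintro ⟨j, ⟨v, hv, hj⟩, hk⟩
    exact ⟨v, hv, j, hj, hk⟩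
  · rintro ⟨v, hv, j, hj, hk⟩
    exact ⟨j, ⟨v, hv, hj⟩, hk⟩

theorem sum_mul_extendZero_eq_zero {M : Matrix ρ ι ℤ} {S : Finset ι} {k : ρ}
    (hk : k ∉ rowsMeeting M S) (y : S → ℚ) :
    ∑ j, (M k j : ℚ) * extendZero S y j = 0 := by
  rw [sum_mul_extendZero S y fun j => (M k j : ℚ)]
  refine sum_eq_zero fun j _ => ?_
  have : M k j = 0 := by
    by_contra h
    exact hk (mem_rowsMeeting.2 ⟨j, j.2, h⟩)
  simp [this]

theorem ColIndep.injective_ratBlock {M : Matrix ρ ι ℤ} (hM : ColIndep M) (S : Finset ι) :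
    Function.Injective (ratBlock M (rowsMeeting M S) S).mulVecLin := by
  rw [← LinearMap.ker_eq_bot, LinearMap.ker_eq_bot']
  intro y hy
  ext j
  have := hM (extendZero S y) (fun k => ?_) j
  · simpa [extendZero] using this
  · by_cases hk : k ∈ rowsMeeting M S
    · rw [← ratBlock_mulVec M (rowsMeeting M S) S y ⟨k, hk⟩]
      exact congrFun hy ⟨k, hk⟩
    · exact sum_mul_extendZero_eq_zero hk y

theorem ColIndep.card_le_card_rowsMeeting {M : Matrix ρ ι ℤ} (hM : ColIndep M) (S : Finset ι) :
    #S ≤ #(rowsMeeting M S) := by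
  simpa using LinearMap.finrank_le_finrank_of_injective (hM.injective_ratBlock S)

/-- A set of columns is tight if it meets only as many rows as it has elements. -/
def IsTight (M : Matrix ρ ι ℤ) (S : Finset ι) : Prop :=
  #(rowsMeeting M S) ≤ #S

theorem IsTight.card_eq {M : Matrix ρ ι ℤ} {S : Finset ι} (h : IsTight M S) (hM : ColIndep M) :
    #(rowsMeeting M S) = #S :=
  le_antisymm h (hM.card_le_card_rowsMeeting S)

/-- The number of rows met is a submodular function of the column set, and independence bounds it
below on the intersection. -/
theorem IsTight.union {M : Matrix ρ ι ℤ} (hM : ColIndep M) {S S' : Finset ι} (h : IsTight M S)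
    (h' : IsTight M S') : IsTight M (S ∪ S') := by
  unfold IsTight at *
  rw [rowsMeeting_union]
  have h1 := card_union_add_card_inter (rowsMeeting M S) (rowsMeeting M S')
  have h2 := card_union_add_card_inter S S'
  have h3 := hM.card_le_card_rowsMeeting (S ∩ S')
  have h4 : #(rowsMeeting M (S ∩ S')) ≤ #(rowsMeeting M S ∩ rowsMeeting M S') :=
    card_le_card (subset_inter (rowsMeeting_mono M inter_subset_left)
      (rowsMeeting_mono M inter_subset_right))
  omega

theorem isTight_biUnion {M : Matrix ρ ι ℤ} (hM : ColIndep M) {α : Type} [DecidableEq α]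
    (L : Finset α) (S : α → Finset ι) (h : ∀ v ∈ L, IsTight M (S v)) :
    IsTight M (L.biUnion S) := by
  induction L using Finset.induction_on with
  | empty => simp [IsTight, rowsMeeting]
  | insert v L _ ih =>
    rw [biUnion_insert]
    exact (h v (mem_insert_self _ _)).union hM
      (ih fun w hw => h w (mem_insert_of_mem hw))

theorem IsTight.surjective_ratBlock {M : Matrix ρ ι ℤ} {S : Finset ι} (h : IsTight M S)
    (hM : ColIndep M) : Function.Surjective (ratBlock M (rowsMeeting M S) S).mulVecLin := by
  refine (LinearMap.injective_iff_surjective_of_finrank_eq_finrank ?_).1 (hM.injective_ratBlock S)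
  simp [h.card_eq hM]

/-- If `N` is tight, the block of the columns outside of `N` and the rows not meeting `N` has
linearly independent columns. -/
theorem IsTight.eq_zero_of_sdiff {M : Matrix ρ ι ℤ} (hM : ColIndep M) {S N : Finset ι}
    (hN : IsTight M N) (y : ↥(S \ N) → ℚ)
    (hy : ∀ k ∈ rowsMeeting M S \ rowsMeeting M N,
      ∑ j : ↥(S \ N), (M k j : ℚ) * y j = 0) (j : ↥(S \ N)) : y j = 0 := by
  -- The vector `z` on `N` cancels the contribution of `y` in the rows meeting `N`, so that `y` and
  -- `z` together form a kernel vector of `M`.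
  obtain ⟨z, hz⟩ := hN.surjective_ratBlock hM
    fun k => -∑ j, (M k j : ℚ) * extendZero (S \ N) y j
  have key := hM (fun j => extendZero (S \ N) y j + extendZero N z j) (fun k => ?_) j
  · have hj := mem_sdiff.1 j.2
    simpa [extendZero, hj] using key
  · simp only [mul_add, sum_add_distrib]
    by_cases hk : k ∈ rowsMeeting M N
    · have := congrFun hz ⟨k, hk⟩
      rw [Matrix.mulVecLin_apply, ratBlock_mulVec] at this
      simp only at this
      rw [this, add_neg_cancel]
    · rw [sum_mul_extendZero_eq_zero hk, add_zero]
      by_cases hk' : k ∈ rowsMeeting M S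
      · rw [sum_mul_extendZero _ y fun j => (M k j : ℚ)]
        exact hy k (mem_sdiff.2 ⟨hk', hk⟩)
      · exact sum_mul_extendZero_eq_zero
          (fun h => hk' (rowsMeeting_mono M sdiff_subset h)) y

end Support

/-! ### Integrality and bounded determinants -/

/-- The integers as a subring of the rationals. -/
abbrev ratInt : Subring ℚ := (Int.castRingHom ℚ).range

theorem intCast_mem_ratInt (t : ℤ) : (t : ℚ) ∈ ratInt := ⟨t, rfl⟩

theorem natCast_mem_ratInt (t : ℕ) : (t : ℚ) ∈ ratInt := ⟨t, by simp⟩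

/-- Cramer's rule: multiply by the adjugate, which is integral. -/
theorem det_mul_mem_ratInt {κ : Type} [Fintype κ] [DecidableEq κ] (M : Matrix κ κ ℤ) (x : κ → ℚ)
    (hx : ∀ k, ∑ j, (M k j : ℚ) * x j ∈ ratInt) (j : κ) : (M.det : ℚ) * x j ∈ ratInt := by
  have h : (M.map (Int.cast : ℤ → ℚ)).adjugate.mulVec ((M.map (Int.cast : ℤ → ℚ)).mulVec x) j
      = (M.det : ℚ) * x j := by
    rw [Matrix.mulVec_mulVec, Matrix.adjugate_mul, Matrix.smul_mulVec, Matrix.one_mulVec]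
    simp [← Int.cast_det]
  have h' : (M.map (Int.cast : ℤ → ℚ)).adjugate = M.adjugate.map (Int.cast : ℤ → ℚ) :=
    ((Int.castRingHom ℚ).map_adjugate M).symm
  rw [← h, h']
  exact sum_mem fun k _ => mul_mem (intCast_mem_ratInt _) (hx k)

/-- A common multiple of all possible determinants of integer matrices of size at most `n`
with entries bounded by `a`. -/
def detMultiple (a n : ℕ) : ℕ := (n.factorial * (a + 1) ^ n).factorial

theorem natAbs_det_dvd_detMultiple {κ : Type} [Fintype κ] [DecidableEq κ] (M : Matrix κ κ ℤ)
    {a n : ℕ} (hn : Fintype.card κ ≤ n) (ha : ∀ i j, (M i j).natAbs ≤ a) (hM : M.det ≠ 0) :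
    M.det.natAbs ∣ detMultiple a n := by
  refine Nat.dvd_factorial (Int.natAbs_pos.2 hM) ?_
  have h := Matrix.det_le (A := M) (abv := AbsoluteValue.abs) (x := (a : ℤ)) fun i j => by
    have := ha i j
    rw [AbsoluteValue.abs_apply, Int.abs_eq_natAbs]
    exact_mod_cast this
  have h2 : M.det.natAbs ≤ (Fintype.card κ).factorial * a ^ Fintype.card κ := by
    zify
    simpa [AbsoluteValue.abs_apply, nsmul_eq_mul] using h
  refine h2.trans (Nat.mul_le_mul (Nat.factorial_le hn) ?_)
  -- The base `a + 1` makes the power monotone in the exponent even when `a = 0`.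
  exact (Nat.pow_le_pow_left a.le_succ _).trans (Nat.pow_le_pow_right (by omega) hn)

/-! ### Subtrees and depth -/

namespace RootedForest

variable {κ : Type} [Fintype κ] (F : RootedForest κ)

open Classical in
/-- The vertices of the subtree below `v`. -/
noncomputable def subtree (v : κ) : Finset κ := univ.filter fun u => F.anc v u

theorem mem_subtree {u v : κ} : u ∈ F.subtree v ↔ F.anc v u := by
  simp [subtree]

theorem depth_lt_depth {u v : κ} (h : F.anc u v) (hne : u ≠ v) : F.depth u < F.depth v := by
  refine Set.ncard_lt_ncard ?_ (Set.toFinite _)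
  refine ⟨fun w hw => F.anc_trans _ _ _ hw h, fun hsub => hne ?_⟩
  exact F.anc_antisymm _ _ h (hsub (F.anc_refl v))

theorem depth_le_depth {u v : κ} (h : F.anc u v) : F.depth u ≤ F.depth v := by
  rcases eq_or_ne u v with rfl | hne
  · exact le_rfl
  · exact (F.depth_lt_depth h hne).le

end RootedForest

/-! ### Cores of tight subtrees and induction on depth -/

section Core

variable {ρ ι : Type} [Fintype ρ] [Fintype ι] [DecidableEq ρ] [DecidableEq ι]

/-- The non-zero entries of every row of `M` lie on a path from a root of `F`. -/
def RowsOnPaths (M : Matrix ρ ι ℤ) (F : RootedForest ι) : Prop :=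
  ∀ k i j, M k i ≠ 0 → M k j ≠ 0 → F.anc i j ∨ F.anc j i

theorem RowsOnPaths.disjoint {M : Matrix ρ ι ℤ} {F : RootedForest ι} (hF : RowsOnPaths M F)
    {S S' : Finset ι} (h : ∀ i ∈ S, ∀ j ∈ S', ¬ F.anc i j ∧ ¬ F.anc j i) :
    Disjoint (rowsMeeting M S) (rowsMeeting M S') := by
  rw [disjoint_left]
  intro k hk hk'
  obtain ⟨i, hi, hki⟩ := mem_rowsMeeting.1 hk
  obtain ⟨j, hj, hkj⟩ := mem_rowsMeeting.1 hk'
  exact (hF k i j hki hkj).elim (h i hi j hj).1 (h i hi j hj).2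

/-- Every vertex of a square non-singular matrix has a tight ancestor. -/
theorem exists_tight_ancestor {M : Matrix ρ ι ℤ} (hM : ColIndep M) {F : RootedForest ι}
    (hF : RowsOnPaths M F) (hcard : Fintype.card ρ = Fintype.card ι) (v : ι) :
    ∃ t, F.anc t v ∧ IsTight M (F.subtree t) := by
  classical
  -- The ancestor of least depth is the root of the tree of `v`. Its tree shares no row with the
  -- other columns, which need at least as many rows as their number; squareness leaves no surplus
  -- row for the tree.
  obtain ⟨t, ht, hmin⟩ := exists_min_image (univ.filter fun u => F.anc u v) F.depth
    ⟨v, by simp [F.anc_refl]⟩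
  simp only [mem_filter, mem_univ, true_and] at ht hmin
  have hroot : ∀ u, F.anc u t → u = t := by
    intro u hu
    by_contra hne
    exact absurd (hmin u (F.anc_trans _ _ _ hu ht)) (F.depth_lt_depth hu hne).not_ge
  refine ⟨t, ht, ?_⟩
  have hdis : Disjoint (rowsMeeting M (F.subtree t)) (rowsMeeting M (F.subtree t)ᶜ) := by
    refine hF.disjoint fun i hi j hj => ?_
    rw [mem_compl, F.mem_subtree] at hj
    rw [F.mem_subtree] at hi
    refine ⟨fun h => hj (F.anc_trans _ _ _ hi h), fun h => ?_⟩
    rcases F.anc_chain _ _ _ hi h with h' | h'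
    · exact hj h'
    · exact hj (hroot j h' ▸ F.anc_refl _)
  have h1 := card_union_of_disjoint hdis
  have h2 := card_le_univ (rowsMeeting M (F.subtree t) ∪ rowsMeeting M (F.subtree t)ᶜ)
  have h3 := hM.card_le_card_rowsMeeting (F.subtree t)ᶜ
  have h4 := card_add_card_compl (F.subtree t)
  unfold IsTight
  omega

open Classical in
/-- The columns below `t` that lie below a further tight subtree. -/
noncomputable def tightBelow (M : Matrix ρ ι ℤ) (F : RootedForest ι) (t : ι) : Finset ι :=
  (univ.filter fun s => F.anc t s ∧ s ≠ t ∧ IsTight M (F.subtree s)).biUnion F.subtree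

theorem mem_tightBelow {M : Matrix ρ ι ℤ} {F : RootedForest ι} {t v : ι} :
    v ∈ tightBelow M F t ↔
      ∃ s, (F.anc t s ∧ s ≠ t ∧ IsTight M (F.subtree s)) ∧ F.anc s v := by
  simp [tightBelow, F.mem_subtree]

theorem isTight_tightBelow {M : Matrix ρ ι ℤ} (hM : ColIndep M) (F : RootedForest ι) (t : ι) :
    IsTight M (tightBelow M F t) := by
  unfold tightBelow
  convert isTight_biUnion hM _ F.subtree fun v hv => ?_ using 2
  simp only [mem_filter] at hv
  exact hv.2.2.2

theorem tightBelow_subset (M : Matrix ρ ι ℤ) (F : RootedForest ι) (t : ι) :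
    tightBelow M F t ⊆ F.subtree t := by
  intro v hv
  obtain ⟨s, hs, hsv⟩ := mem_tightBelow.1 hv
  exact F.mem_subtree.2 (F.anc_trans _ _ _ hs.1 hsv)

/-- The core of a tight subtree: the columns not below a further tight subtree. -/
noncomputable def core (M : Matrix ρ ι ℤ) (F : RootedForest ι) (t : ι) : Finset ι :=
  F.subtree t \ tightBelow M F t

/-- Each core vertex of depth `i` roots a subtree that is not tight and so has a surplus row. These
subtrees share no rows with each other or with the rest of the subtree of `t` once the shallower
core vertices `P` are deleted. As the subtree of `t` is tight, only the deleted columns can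
compensate for the surplus, whence `#L ≤ #P`. -/
theorem card_core_depth_le {M : Matrix ρ ι ℤ} (hM : ColIndep M) {F : RootedForest ι}
    (hF : RowsOnPaths M F) {t : ι} (ht : IsTight M (F.subtree t)) {i : ℕ} (hi : F.depth t < i) :
    #((core M F t).filter fun v => F.depth v = i) ≤
      #((core M F t).filter fun v => F.depth v < i) := by
  set L := (core M F t).filter fun v => F.depth v = i with hL
  set P := (core M F t).filter fun v => F.depth v < i with hP
  have hLmem : ∀ v, v ∈ L → (F.anc t v ∧ v ∉ tightBelow M F t) ∧ F.depth v = i := fun v hv => by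
    simpa [hL, core, F.mem_subtree] using hv
  set X := L.biUnion F.subtree with hX
  set W := F.subtree t \ P with hW
  have hPS : P ⊆ F.subtree t := (filter_subset _ _).trans sdiff_subset
  have hincomp : ∀ v ∈ L, ∀ w ∈ L, F.anc v w → v = w := by
    intro v hv w hw h
    by_contra hne
    have := F.depth_lt_depth h hne
    rw [(hLmem v hv).2, (hLmem w hw).2] at this
    exact lt_irrefl _ this
  have hdisX : #(rowsMeeting M X) = ∑ v ∈ L, #(rowsMeeting M (F.subtree v)) := by
    rw [hX, rowsMeeting_biUnion]
    refine card_biUnion fun v hv w hw hne => hF.disjoint fun a ha b hb => ?_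
    rw [F.mem_subtree] at ha hb
    constructor
    · intro h
      rcases F.anc_chain _ _ _ (F.anc_trans _ _ _ ha h) hb with h' | h'
      · exact hne (hincomp v hv w hw h')
      · exact hne (hincomp w hw v hv h').symm
    · intro h
      rcases F.anc_chain _ _ _ (F.anc_trans _ _ _ hb h) ha with h' | h'
      · exact hne (hincomp w hw v hv h').symm
      · exact hne (hincomp v hv w hw h')
  have hexcess : ∀ v ∈ L, #(F.subtree v) + 1 ≤ #(rowsMeeting M (F.subtree v)) := by
    intro v hv
    by_contra hlt
    obtain ⟨⟨htv, hnot⟩, hd⟩ := hLmem v hv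
    refine hnot (mem_tightBelow.2 ⟨v, ⟨htv, ?_, ?_⟩, F.anc_refl v⟩)
    · rintro rfl
      omega
    · unfold IsTight
      omega
  have hXcard : #X + #L ≤ #(rowsMeeting M X) := by
    rw [hdisX]
    calc #X + #L ≤ ∑ v ∈ L, #(F.subtree v) + ∑ v ∈ L, 1 := by
          rw [sum_const, smul_eq_mul, mul_one]
          exact Nat.add_le_add_right card_biUnion_le _
      _ = ∑ v ∈ L, (#(F.subtree v) + 1) := sum_add_distrib.symm
      _ ≤ _ := sum_le_sum hexcess
  have hXS : X ⊆ F.subtree t := by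
    intro w hw
    obtain ⟨v, hv, hvw⟩ := mem_biUnion.1 hw
    exact F.mem_subtree.2 (F.anc_trans _ _ _ (hLmem v hv).1.1 (F.mem_subtree.1 hvw))
  -- A vertex of `W \ X` comparable to a vertex of `X` would be a proper ancestor of some `v ∈ L`.
  -- In `tightBelow` it would drag `v` out of the core; in the core it would belong to `P`.
  have hdis : Disjoint (rowsMeeting M (W \ X)) (rowsMeeting M X) := by
    refine hF.disjoint fun w hw u hu => ?_
    obtain ⟨v, hv, hvu⟩ := mem_biUnion.1 hu
    rw [F.mem_subtree] at hvu
    obtain ⟨⟨htv, hnot⟩, hd⟩ := hLmem v hv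
    obtain ⟨hwW, hwX⟩ := mem_sdiff.1 hw
    obtain ⟨hwS, hwP⟩ := mem_sdiff.1 hwW
    have hvw : ¬ F.anc v w := fun h => hwX (mem_biUnion.2 ⟨v, hv, F.mem_subtree.2 h⟩)
    refine ⟨fun h => ?_, fun h => hvw (F.anc_trans _ _ _ hvu h)⟩
    rcases F.anc_chain _ _ _ h hvu with h' | h'
    · by_cases hN : w ∈ tightBelow M F t
      · obtain ⟨s, hs, hsw⟩ := mem_tightBelow.1 hN
        exact hnot (mem_tightBelow.2 ⟨s, hs, F.anc_trans _ _ _ hsw h'⟩)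
      · refine hwP (mem_filter.2 ⟨mem_sdiff.2 ⟨hwS, hN⟩, ?_⟩)
        rw [← hd]
        refine F.depth_lt_depth h' ?_
        rintro rfl
        exact hvw (F.anc_refl _)
    · exact hvw h'
  have h1 := card_union_of_disjoint hdis
  have h2 : #(rowsMeeting M (W \ X) ∪ rowsMeeting M X) ≤ #(rowsMeeting M (F.subtree t)) :=
    card_le_card (union_subset (rowsMeeting_mono M (sdiff_subset.trans sdiff_subset))
      (rowsMeeting_mono M hXS))
  have h3 := hM.card_le_card_rowsMeeting (W \ X)
  have h4 := card_sdiff_add_card_eq_card hPS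
  rw [← hW] at h4
  have h5 := card_le_card_sdiff_add_card (s := W) (t := X)
  unfold IsTight at ht
  omega

/-- Each level at most doubles the number of core vertices seen so far, starting from `t` alone. -/
theorem card_core_le {M : Matrix ρ ι ℤ} (hM : ColIndep M) {F : RootedForest ι}
    (hF : RowsOnPaths M F) {t : ι} (ht : IsTight M (F.subtree t)) {h : ℕ}
    (hh : ∀ v, F.depth v ≤ h) : #(core M F t) ≤ 2 ^ (h + 1) := by
  have key : ∀ i, #((core M F t).filter fun v => F.depth v < i) ≤ 2 ^ i := by
    intro i
    induction i with
    | zero => simp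
    | succ i ih =>
      rcases lt_or_ge (F.depth t) i with hi | hi
      · have h1 := card_core_depth_le hM hF ht hi
        have h2 : ((core M F t).filter fun v => F.depth v < i + 1) ⊆
            ((core M F t).filter fun v => F.depth v < i) ∪
              ((core M F t).filter fun v => F.depth v = i) := by
          intro v hv
          simp only [mem_union, mem_filter] at hv ⊢
          rcases Nat.lt_succ_iff_lt_or_eq.1 hv.2 with h | h
          · exact Or.inl ⟨hv.1, h⟩
          · exact Or.inr ⟨hv.1, h⟩
        have h3 := (card_le_card h2).trans (card_union_le _ _)
        rw [pow_succ]
        omega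
      · refine (card_le_one.2 fun v hv w hw => ?_).trans Nat.one_le_two_pow
        have aux : ∀ v ∈ (core M F t).filter fun v => F.depth v < i + 1, t = v := by
          intro v hv
          simp only [mem_filter, core, mem_sdiff, F.mem_subtree] at hv
          by_contra hne
          have := F.depth_lt_depth hv.1.1 hne
          omega
        exact (aux v hv).symm.trans (aux w hw)
  have := key (h + 1)
  rwa [filter_true_of_mem fun v _ => Nat.lt_succ_of_le (hh v)] at this

/-- The common denominator associated with coefficients at most `a` and height at most `h`. -/
def denomBound (a h : ℕ) : ℕ := detMultiple a (2 ^ (h + 1)) ^ h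

theorem denomBound_pos (a h : ℕ) : 0 < denomBound a h :=
  pow_pos (Nat.factorial_pos _) _

/-- Induction on depth: Cramer's rule on the core containing `v` costs one factor, and the remaining
unknowns in its rows are proper ancestors of the root of that core, hence shallower than `v`. -/
theorem depth_pow_mul_mem_ratInt {M : Matrix ρ ι ℤ} (hM : ColIndep M) {F : RootedForest ι}
    (hF : RowsOnPaths M F) (hcard : Fintype.card ρ = Fintype.card ι) {a h : ℕ}
    (ha : ∀ k j, (M k j).natAbs ≤ a) (hh : ∀ v, F.depth v ≤ h) (x : ι → ℚ)
    (hx : ∀ k, ∑ j, (M k j : ℚ) * x j ∈ ratInt) :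
    ∀ d v, F.depth v ≤ d → ((detMultiple a (2 ^ (h + 1)) ^ d : ℕ) : ℚ) * x v ∈ ratInt := by
  classical
  intro d
  induction d with
  | zero =>
    intro v hv
    have : 0 < F.depth v := Set.ncard_pos (Set.toFinite _) |>.2 ⟨v, F.anc_refl v⟩
    omega
  | succ d ih =>
    intro v hv
    obtain ⟨t₀, ht₀⟩ := exists_tight_ancestor hM hF hcard v
    -- Taking the deepest tight ancestor places `v` in the core of `t`.
    obtain ⟨t, ht, hmax⟩ := exists_max_image
      (univ.filter fun t => F.anc t v ∧ IsTight M (F.subtree t)) F.depth ⟨t₀, by simpa using ht₀⟩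
    simp only [mem_filter, mem_univ, true_and] at ht hmax
    obtain ⟨htv, htight⟩ := ht
    set S := F.subtree t with hS
    set N := tightBelow M F t with hN
    have hNt : IsTight M N := isTight_tightBelow hM F t
    have hNS : N ⊆ S := tightBelow_subset M F t
    have hvC : v ∈ S \ N := by
      refine mem_sdiff.2 ⟨F.mem_subtree.2 htv, fun h => ?_⟩
      obtain ⟨s, ⟨hts, hne, hst⟩, hsv⟩ := mem_tightBelow.1 h
      exact absurd (hmax s ⟨hsv, hst⟩) (F.depth_lt_depth hts hne.symm).not_ge
    have hcardP : #(S \ N) = #(rowsMeeting M S \ rowsMeeting M N) := by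
      rw [card_sdiff_of_subset hNS, card_sdiff_of_subset (rowsMeeting_mono M hNS),
        htight.card_eq hM, hNt.card_eq hM]
    let e : ↥(S \ N) ≃ ↥(rowsMeeting M S \ rowsMeeting M N) :=
      Fintype.equivOfCardEq (by rw [Fintype.card_coe, Fintype.card_coe]; exact hcardP)
    let B : Matrix ↥(S \ N) ↥(S \ N) ℤ := Matrix.of fun k j => M (e k) j
    have hdet : B.det ≠ 0 := by
      intro h0
      have h0' : (B.map (Int.cast : ℤ → ℚ)).det = 0 := by
        rw [← Int.cast_det, h0, Int.cast_zero]
      obtain ⟨y, hy0, hy⟩ := Matrix.exists_mulVec_eq_zero_iff.2 h0'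
      refine hy0 (funext fun j => hNt.eq_zero_of_sdiff hM y (fun k hk => ?_) j)
      have := congrFun hy (e.symm ⟨k, hk⟩)
      simpa [Matrix.mulVec, dotProduct, B] using this
    have hdvd : B.det.natAbs ∣ detMultiple a (2 ^ (h + 1)) :=
      natAbs_det_dvd_detMultiple B (by rw [Fintype.card_coe]; exact card_core_le hM hF htight hh)
        (fun i j => ha _ _) hdet
    set D := detMultiple a (2 ^ (h + 1)) with hD
    have hB : (B.det : ℚ) * (((D ^ d : ℕ) : ℚ) * x v) ∈ ratInt := by
      refine det_mul_mem_ratInt B (fun j => ((D ^ d : ℕ) : ℚ) * x j) (fun k => ?_) ⟨v, hvC⟩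
      obtain ⟨hkS, hkN⟩ := mem_sdiff.1 (e k).2
      -- Columns outside the core move to the right-hand side, where the induction hypothesis makes
      -- their non-zero terms integral.
      have hsplit : ∑ j : ↥(S \ N), (B k j : ℚ) * (((D ^ d : ℕ) : ℚ) * x j) =
          ((D ^ d : ℕ) : ℚ) * ∑ j, (M (e k) j : ℚ) * x j -
            ∑ j ∈ (S \ N)ᶜ, (M (e k) j : ℚ) * (((D ^ d : ℕ) : ℚ) * x j) := by
        rw [eq_sub_iff_add_eq, mul_sum, ← sum_add_sum_compl (S \ N)]
        congr 1
        · rw [← sum_coe_sort (S \ N)]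
          exact sum_congr rfl fun j _ => mul_left_comm _ _ _
        · exact sum_congr rfl fun j _ => mul_left_comm _ _ _
      rw [hsplit]
      refine sub_mem (mul_mem (natCast_mem_ratInt _) (hx _)) (sum_mem fun j hj => ?_)
      by_cases hkj : M (e k) j = 0
      · simp [hkj]
      refine mul_mem (intCast_mem_ratInt _) (ih j ?_)
      have hjN : j ∉ N := fun h => hkN (mem_rowsMeeting.2 ⟨j, h, hkj⟩)
      have hjS : ¬ F.anc t j := fun h =>
        (mem_compl.1 hj) (mem_sdiff.2 ⟨F.mem_subtree.2 h, hjN⟩)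
      obtain ⟨i, hi, hki⟩ := mem_rowsMeeting.1 hkS
      rw [hS, F.mem_subtree] at hi
      -- The row also meets the subtree of `t`, so a non-zero column outside that subtree lies above
      -- `t` on the same root path.
      have hjt : F.anc j t := by
        rcases hF _ _ _ hki hkj with h | h
        · exact absurd (F.anc_trans _ _ _ hi h) hjS
        · exact (F.anc_chain _ _ _ hi h).resolve_left hjS
      have h1 := F.depth_lt_depth hjt (by rintro rfl; exact hjS (F.anc_refl _))
      have h2 := F.depth_le_depth htv
      omega
    obtain ⟨c, hc⟩ := hdvd
    obtain ⟨b, hb⟩ : (B.det) ∣ (D : ℤ) := Int.natAbs_dvd.1 ⟨c, by exact_mod_cast hc⟩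
    have hb' : (D : ℚ) = (B.det : ℚ) * b := by exact_mod_cast congrArg (Int.cast : ℤ → ℚ) hb
    have : ((D ^ (d + 1) : ℕ) : ℚ) * x v = b * ((B.det : ℚ) * (((D ^ d : ℕ) : ℚ) * x v)) := by
      rw [pow_succ, Nat.cast_mul, hb']
      ring
    rw [this]
    exact mul_mem (intCast_mem_ratInt _) hB

/-- Integral right hand sides have solutions with bounded denominators. -/
theorem denomBound_mul_mem_ratInt {M : Matrix ρ ι ℤ} (hM : ColIndep M) {F : RootedForest ι}
    (hF : RowsOnPaths M F) (hcard : Fintype.card ρ = Fintype.card ι) {a h : ℕ}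
    (ha : ∀ k j, (M k j).natAbs ≤ a) (hh : ∀ v, F.depth v ≤ h) (x : ι → ℚ)
    (hx : ∀ k, ∑ j, (M k j : ℚ) * x j ∈ ratInt) (v : ι) :
    (denomBound a h : ℚ) * x v ∈ ratInt :=
  depth_pow_mul_mem_ratInt hM hF hcard ha hh x hx h v (hh v)

end Core

/-! ### Induced forests and treedepth -/

/-- Some forest of height at most `h` has every row of `M` on a path from a root. -/
def PrimalTdLE {ρ ι : Type} (M : Matrix ρ ι ℤ) (h : ℕ) : Prop :=
  ∃ F : RootedForest ι, RowsOnPaths M F ∧ ∀ v, F.depth v ≤ h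

/-- The forest induced on the vertices selected by an injective map. -/
def RootedForest.comap {T V : Type} (F : RootedForest T) (φ : V → T)
    (hφ : Function.Injective φ) : RootedForest V where
  anc u v := F.anc (φ u) (φ v)
  anc_refl _ := F.anc_refl _
  anc_trans _ _ _ h h' := F.anc_trans _ _ _ h h'
  anc_antisymm _ _ h h' := hφ (F.anc_antisymm _ _ h h')
  anc_chain _ _ _ h h' := F.anc_chain _ _ _ h h'

theorem RootedForest.depth_comap_le {T V : Type} [Finite T] (F : RootedForest T) (φ : V → T)
    (hφ : Function.Injective φ) (v : V) : (F.comap φ hφ).depth v ≤ F.depth (φ v) :=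
  Set.ncard_le_ncard_of_injOn φ (fun _ hu => hu) hφ.injOn (Set.toFinite _)

theorem PrimalTdLE.submatrix {ρ ι ρ' ι' : Type} [Finite ι] {M : Matrix ρ ι ℤ} {h : ℕ}
    (hM : PrimalTdLE M h) (r : ρ' → ρ) (c : ι' → ι) (hc : Function.Injective c) :
    PrimalTdLE (M.submatrix r c) h := by
  obtain ⟨F, hF, hh⟩ := hM
  exact ⟨F.comap c hc, fun k i j hi hj => hF (r k) _ _ hi hj,
    fun v => (F.depth_comap_le c hc v).trans (hh _)⟩

theorem RootedForest.IsTdDecomposition.primalTdLE {ρ ι T : Type} [Fintype T] {M : Matrix ρ ι ℤ}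
    {F : RootedForest T} (hF : F.IsTdDecomposition (primalGraph M)) :
    PrimalTdLE M F.height := by
  obtain ⟨φ⟩ := hF
  refine ⟨F.comap φ φ.injective, fun k i j hi hj => ?_,
    fun v => (F.depth_comap_le φ φ.injective v).trans (Finset.le_sup (f := F.depth) (mem_univ _))⟩
  rcases eq_or_ne i j with rfl | hne
  · exact Or.inl (F.anc_refl _)
  · have hadj : (primalGraph M).Adj i j := ⟨hne, k, hi, hj⟩
    exact (φ.toHom.map_adj hadj).2

/-- A path, as a rooted forest. -/
def RootedForest.ofEquivFin {V : Type} {n : ℕ} (e : V ≃ Fin n) : RootedForest V where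
  anc u v := e u ≤ e v
  anc_refl _ := le_rfl
  anc_trans _ _ _ h h' := h.trans h'
  anc_antisymm _ _ h h' := e.injective (le_antisymm h h')
  anc_chain u v _ _ _ := le_total (e u) (e v)

/-- A path decomposes every graph, so the infimum is over a non-empty set and is attained rather
than the default `0`. -/
theorem exists_isTdDecomposition_height_eq {V : Type} [Fintype V] (G : SimpleGraph V) :
    ∃ F : RootedForest V, F.IsTdDecomposition G ∧ F.height = treedepth G := by
  refine Nat.sInf_mem (s := {h | ∃ F : RootedForest V, F.IsTdDecomposition G ∧ F.height = h})
    ⟨_, RootedForest.ofEquivFin (Fintype.equivFin V), ?_, rfl⟩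
  exact ⟨⟨⟨id, fun {u v} h => ⟨h.ne, le_total (Fintype.equivFin V u) (Fintype.equivFin V v)⟩⟩,
    Function.injective_id⟩⟩

theorem primalTdLE_treedepth {ρ ι : Type} [Fintype ι] (M : Matrix ρ ι ℤ) :
    PrimalTdLE M (treedepth (primalGraph M)) := by
  obtain ⟨F, hF, hh⟩ := exists_isTdDecomposition_height_eq (primalGraph M)
  exact hh ▸ hF.primalTdLE

theorem natAbs_le_maxCoeff {ρ ι : Type} [Fintype ρ] [Fintype ι] (M : Matrix ρ ι ℤ) (k : ρ) (j : ι) :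
    (M k j).natAbs ≤ maxCoeff M :=
  Finset.le_sup (f := fun p : ρ × ι => (M p.1 p.2).natAbs) (mem_univ (k, j))

/-! ### Denominators of inverses and of solutions of independent systems -/

section Inverse

variable {κ : Type} [Fintype κ] [DecidableEq κ]

theorem colIndep_of_det_ne_zero {M : Matrix κ κ ℤ}
    (hM : (M.map (Int.cast : ℤ → ℚ)).det ≠ 0) : ColIndep M := by
  intro y hy
  exact congrFun (Matrix.eq_zero_of_mulVec_eq_zero hM (funext hy))

theorem PrimalTdLE.denomBound_mul_inv {M : Matrix κ κ ℤ} {a h : ℕ} (hT : PrimalTdLE M h)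
    (ha : ∀ i j, (M i j).natAbs ≤ a) (hM : (M.map (Int.cast : ℤ → ℚ)).det ≠ 0) (i j : κ) :
    (denomBound a h : ℚ) * (M.map (Int.cast : ℤ → ℚ))⁻¹ i j ∈ ratInt := by
  obtain ⟨F, hF, hh⟩ := hT
  refine denomBound_mul_mem_ratInt (colIndep_of_det_ne_zero hM) hF rfl ha hh
    (fun i => (M.map (Int.cast : ℤ → ℚ))⁻¹ i j) (fun k => ?_) i
  have := congrFun (congrFun (Matrix.mul_nonsing_inv _ (isUnit_iff_ne_zero.2 hM)) k) j
  rw [Matrix.mul_apply] at this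
  simp only [Matrix.map_apply] at this
  rw [this, Matrix.one_apply]
  split_ifs
  exacts [one_mem _, zero_mem _]

/-- Inversion commutes with transposition, so a bound on all entries of the inverse transfers
between the primal and the dual case. -/
theorem denomBound_mul_inv {M : Matrix κ κ ℤ} {a h : ℕ}
    (hT : PrimalTdLE M h ∨ PrimalTdLE M.transpose h) (ha : ∀ i j, (M i j).natAbs ≤ a)
    (hM : (M.map (Int.cast : ℤ → ℚ)).det ≠ 0) (i j : κ) :
    (denomBound a h : ℚ) * (M.map (Int.cast : ℤ → ℚ))⁻¹ i j ∈ ratInt := by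
  rcases hT with hT | hT
  · exact hT.denomBound_mul_inv ha hM i j
  · have := hT.denomBound_mul_inv (fun i j => ha j i)
      (by rwa [Matrix.transpose_map, Matrix.det_transpose]) j i
    rwa [Matrix.transpose_map, ← Matrix.transpose_nonsing_inv, Matrix.transpose_apply] at this

theorem den_le_of_mul_mem_ratInt {D : ℕ} (hD : 0 < D) {x : ℚ} (h : (D : ℚ) * x ∈ ratInt) :
    x.den ≤ D := by
  obtain ⟨t, ht⟩ := h
  have hx : x = Rat.divInt t D := by
    rw [Rat.divInt_eq_div]
    field_simp
    simpa [mul_comm] using ht.symm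
  exact Nat.le_of_dvd hD (by rw [hx]; exact_mod_cast Rat.den_dvd t D)

end Inverse

/-- A matrix with independent columns has a non-singular maximal square submatrix. -/
theorem exists_rows_det_ne_zero {ρ κ : Type} [Fintype ρ] [Fintype κ] [DecidableEq κ]
    (M : Matrix ρ κ ℚ) (hM : ∀ y : κ → ℚ, M.mulVec y = 0 → y = 0) :
    ∃ r : κ → ρ, Function.Injective r ∧ (M.submatrix r id).det ≠ 0 := by
  obtain ⟨σ, f, hf, hspan, hli⟩ := exists_linearIndependent' ℚ M.row
  have : Finite σ := Finite.of_injective f hf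
  have : Fintype σ := Fintype.ofFinite σ
  have hcols : LinearIndependent ℚ M.col := by
    rw [← Matrix.mulVec_injective_iff]
    exact (injective_iff_map_eq_zero M.mulVecLin).2 hM
  have hcard : Fintype.card κ = Fintype.card σ := by
    rw [← hcols.rank_matrix, Matrix.rank_transpose, Matrix.rank_eq_finrank_span_row, ← hspan,
      finrank_span_eq_card hli]
  let e : κ ≃ σ := Fintype.equivOfCardEq hcard
  refine ⟨f ∘ e, hf.comp e.injective, ?_⟩
  have : LinearIndependent ℚ (M.submatrix (f ∘ e) id).row := hli.comp e e.injective
  rw [Matrix.linearIndependent_rows_iff_isUnit, Matrix.isUnit_iff_isUnit_det] at this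
  exact this.ne_zero

/-- Selecting rows that form a non-singular square matrix `B` reduces to its inverse, since `x = B⁻¹
(B x)` with `B x` integral. -/
theorem denomBound_mul_mem_ratInt_of_indep {ρ κ : Type} [Fintype ρ] [Fintype κ] [DecidableEq κ]
    {M : Matrix ρ κ ℤ} {a h : ℕ} (hT : PrimalTdLE M h ∨ PrimalTdLE M.transpose h)
    (ha : ∀ k j, (M k j).natAbs ≤ a) (hM : ColIndep M) (x : κ → ℚ)
    (hx : ∀ k, ∑ j, (M k j : ℚ) * x j ∈ ratInt) (j : κ) :
    (denomBound a h : ℚ) * x j ∈ ratInt := by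
  obtain ⟨r, hr, hdet⟩ := exists_rows_det_ne_zero (M.map (Int.cast : ℤ → ℚ))
    fun y hy => funext (hM y (congrFun hy))
  have hinv := denomBound_mul_inv (M := M.submatrix r id) (a := a) (h := h)
    (hT.imp (fun h => h.submatrix r id Function.injective_id) fun h => h.submatrix id r hr)
    (fun _ _ => ha _ _) hdet
  set B := (M.submatrix r id).map (Int.cast : ℤ → ℚ)
  have hunit : IsUnit B.det := isUnit_iff_ne_zero.2 hdet
  have hx' : x j = B⁻¹.mulVec (B.mulVec x) j := by
    rw [Matrix.mulVec_mulVec, Matrix.nonsing_inv_mul _ hunit, Matrix.one_mulVec]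
  rw [hx', Matrix.mulVec, dotProduct, mul_sum]
  refine sum_mem fun k _ => ?_
  rw [← mul_assoc]
  exact mul_mem (hinv j k) (hx (r k))

/-! ### Basic solutions and existence of an optimum -/

namespace MILP

variable {m z q : ℕ} (I : MILP m z q)

/-- The rational variables that are not at one of their bounds. -/
def freeVars (x : Fin z ⊕ Fin q → ℚ) : Finset (Fin z ⊕ Fin q) :=
  univ.filter fun j => (∃ i, j = Sum.inr i) ∧ (I.l j : ℚ) < x j ∧ x j < (I.u j : ℚ)

/-- The columns of the variables that are not at one of their bounds are independent. -/
def IsBasic (x : Fin z ⊕ Fin q → ℚ) : Prop :=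
  ∀ d : Fin z ⊕ Fin q → ℚ, (∀ j, j ∉ I.freeVars x → d j = 0) →
    (∀ k, ∑ j, (I.A k j : ℚ) * d j = 0) → ∀ j, d j = 0

theorem mem_freeVars {x : Fin z ⊕ Fin q → ℚ} {j : Fin z ⊕ Fin q} :
    j ∈ I.freeVars x ↔ (∃ i, j = Sum.inr i) ∧ (I.l j : ℚ) < x j ∧ x j < (I.u j : ℚ) := by
  simp [freeVars]

/-- A kernel direction supported on the free variables can be followed until one of them reaches a
bound. -/
theorem exists_feasible_freeVars_ssubset {x d : Fin z ⊕ Fin q → ℚ} (hx : I.IsFeasible x)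
    (hd : ∀ j, j ∉ I.freeVars x → d j = 0) (hAd : ∀ k, ∑ j, (I.A k j : ℚ) * d j = 0)
    (hne : ∃ j, d j ≠ 0) (hobj : I.objective d ≤ 0) :
    ∃ y, I.IsFeasible y ∧ I.objective y ≤ I.objective x ∧ I.freeVars y ⊂ I.freeVars x := by
  obtain ⟨hA, hb, hz⟩ := hx
  have hfree : ∀ j, d j ≠ 0 → j ∈ I.freeVars x := fun j hj => by_contra fun h => hj (hd j h)
  -- The step length at which coordinate `j` reaches the bound towards which `d` moves it. The
  -- minimizer `j₀` over the support of `d` is the first to do so and stops being free.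
  let s : Fin z ⊕ Fin q → ℚ := fun j =>
    if 0 < d j then ((I.u j : ℚ) - x j) / d j else ((I.l j : ℚ) - x j) / d j
  obtain ⟨j₀, hj₀, hmin⟩ := exists_min_image (univ.filter fun j => d j ≠ 0) s
    (by obtain ⟨j, hj⟩ := hne; exact ⟨j, by simpa using hj⟩)
  simp only [mem_filter, mem_univ, true_and] at hj₀ hmin
  have hspos : 0 ≤ s j₀ := by
    obtain ⟨-, h1, h2⟩ := I.mem_freeVars.1 (hfree j₀ hj₀)
    by_cases h : 0 < d j₀
    · simp only [s, if_pos h]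
      exact div_nonneg (by linarith) h.le
    · simp only [s, if_neg h]
      exact div_nonneg_of_nonpos (by linarith) (not_lt.1 h)
  have hbound : ∀ j, (I.l j : ℚ) ≤ x j + s j₀ * d j ∧ x j + s j₀ * d j ≤ (I.u j : ℚ) := by
    intro j
    rcases lt_trichotomy (d j) 0 with h | h | h
    · have h1 := hmin j h.ne
      simp only [s, if_neg h.le.not_gt] at h1
      rw [le_div_iff_of_neg h] at h1
      have h2 := mul_nonpos_of_nonneg_of_nonpos hspos h.le
      exact ⟨by simp only [s]; linarith, by linarith [(hb j).2]⟩
    · simpa [h] using hb j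
    · have h1 := hmin j h.ne'
      simp only [s, if_pos h] at h1
      rw [le_div_iff₀ h] at h1
      have h2 := mul_nonneg hspos h.le
      exact ⟨by linarith [(hb j).1], by simp only [s]; linarith⟩
  refine ⟨fun j => x j + s j₀ * d j, ⟨fun k => ?_, hbound, fun i => ?_⟩, ?_, ?_⟩
  · have : ∑ j, (I.A k j : ℚ) * (x j + s j₀ * d j) =
        ∑ j, (I.A k j : ℚ) * x j + s j₀ * ∑ j, (I.A k j : ℚ) * d j := by
      rw [mul_sum, ← sum_add_distrib]
      exact sum_congr rfl fun j _ => by ring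
    rw [this, hAd, mul_zero, add_zero, hA]
  · have : d (Sum.inl i) = 0 := hd _ fun h => by
      obtain ⟨⟨i', hi'⟩, -⟩ := I.mem_freeVars.1 h
      cases hi'
    simpa [this] using hz i
  · have : I.objective (fun j => x j + s j₀ * d j) = I.objective x + s j₀ * I.objective d := by
      simp only [objective]
      rw [mul_sum, ← sum_add_distrib]
      exact sum_congr rfl fun j _ => by ring
    rw [this]
    linarith [mul_nonpos_of_nonneg_of_nonpos hspos hobj]
  · rw [ssubset_iff_of_subset]
    · refine ⟨j₀, hfree j₀ hj₀, fun h => ?_⟩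
      obtain ⟨-, h1, h2⟩ := I.mem_freeVars.1 h
      by_cases hpos : 0 < d j₀
      · simp only [s, if_pos hpos, div_mul_cancel₀ _ hj₀] at h2
        linarith
      · simp only [s, if_neg hpos, div_mul_cancel₀ _ hj₀] at h1
        linarith
    · intro j hj
      by_cases h : d j = 0
      · rw [I.mem_freeVars] at hj ⊢
        simpa [h] using hj
      · exact hfree j h

/-- As long as the free columns are dependent, moving along a kernel direction, with its sign chosen
so that the objective does not increase, removes a free variable. -/
theorem exists_basic_objective_le :
    ∀ (n : ℕ) (x : Fin z ⊕ Fin q → ℚ), #(I.freeVars x) = n → I.IsFeasible x →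
      ∃ y, I.IsFeasible y ∧ I.IsBasic y ∧ I.objective y ≤ I.objective x := by
  intro n
  induction n using Nat.strong_induction_on with
  | _ n ih =>
    intro x hn hx
    by_cases hB : I.IsBasic x
    · exact ⟨x, hx, hB, le_rfl⟩
    · obtain ⟨d, hd, hAd, hne, hobj⟩ : ∃ d : Fin z ⊕ Fin q → ℚ,
          (∀ j, j ∉ I.freeVars x → d j = 0) ∧ (∀ k, ∑ j, (I.A k j : ℚ) * d j = 0) ∧
          (∃ j, d j ≠ 0) ∧ I.objective d ≤ 0 := by
        unfold IsBasic at hB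
        push Not at hB
        obtain ⟨d, hd, hAd, hne⟩ := hB
        rcases le_total (I.objective d) 0 with h | h
        · exact ⟨d, hd, hAd, hne, h⟩
        · refine ⟨-d, fun j hj => by simp [hd j hj], fun k => by simp [hAd k], ?_, ?_⟩
          · simpa using hne
          · simp only [objective, Pi.neg_apply, mul_neg, sum_neg_distrib]
            exact neg_nonpos.2 h
      obtain ⟨y, hy, hyx, hlt⟩ := I.exists_feasible_freeVars_ssubset hx hd hAd hne hobj
      obtain ⟨w, hw, hwB, hwy⟩ := ih _ (hn ▸ card_lt_card hlt) y rfl hy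
      exact ⟨w, hw, hwB, hwy.trans hyx⟩

/-- Coordinates that are not free are integers, because the bounds are. Moved to the right-hand
side, they leave an integral system in the free variables with independent columns. -/
theorem IsBasic.denomBound_mul_mem_ratInt {I : MILP m z q} {h : ℕ}
    (hT : PrimalTdLE I.A h ∨ PrimalTdLE I.A.transpose h) {x : Fin z ⊕ Fin q → ℚ}
    (hB : I.IsBasic x) (hx : I.IsFeasible x) (j : Fin z ⊕ Fin q) :
    (denomBound (maxCoeff I.A) h : ℚ) * x j ∈ ratInt := by
  obtain ⟨hA, hb, hz⟩ := hx
  have hint : ∀ j, j ∉ I.freeVars x → x j ∈ ratInt := by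
    intro j hj
    rcases j with i | i
    · obtain ⟨t, ht⟩ := hz i
      exact ht ▸ intCast_mem_ratInt t
    · rw [mem_freeVars] at hj
      rcases (hb (Sum.inr i)).1.eq_or_lt with h1 | h1
      · exact h1 ▸ intCast_mem_ratInt _
      rcases (hb (Sum.inr i)).2.eq_or_lt with h2 | h2
      · exact h2 ▸ intCast_mem_ratInt _
      exact absurd ⟨⟨i, rfl⟩, h1, h2⟩ hj
  by_cases hj : j ∈ I.freeVars x
  · let c : I.freeVars x → Fin z ⊕ Fin q := Subtype.val
    have hT' : PrimalTdLE (I.A.submatrix id c) h ∨ PrimalTdLE (I.A.submatrix id c).transpose h :=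
      hT.imp (fun h => h.submatrix id c Subtype.val_injective)
        fun h => h.submatrix c id Function.injective_id
    refine denomBound_mul_mem_ratInt_of_indep hT'
      (fun k j => natAbs_le_maxCoeff I.A k (c j)) (fun y hy j => ?_) (fun j => x (c j))
      (fun k => ?_) ⟨j, hj⟩
    · have := hB (extendZero _ y) (fun j hj => by simp [extendZero, hj]) (fun k => by
        rw [sum_mul_extendZero _ y fun j => (I.A k j : ℚ)]
        exact hy k) j
      simpa [extendZero] using this
    · have : ∑ j : I.freeVars x, (I.A k j : ℚ) * x j =
          (I.b k : ℚ) - ∑ j ∈ (I.freeVars x)ᶜ, (I.A k j : ℚ) * x j := by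
        rw [eq_sub_iff_add_eq, ← hA k, ← sum_add_sum_compl (I.freeVars x),
          ← sum_coe_sort (I.freeVars x)]
      change ∑ j : I.freeVars x, (I.A k j : ℚ) * x j ∈ ratInt
      rw [this]
      refine sub_mem (intCast_mem_ratInt _) (sum_mem fun j hj => ?_)
      exact mul_mem (intCast_mem_ratInt _) (hint j (mem_compl.1 hj))
  · exact mul_mem (natCast_mem_ratInt _) (hint j hj)

/-- Scaling by `D` embeds these points into the integer points of a bounded box. -/
theorem finite_feasible_bounded_denominator {D : ℕ} (hD : 0 < D) :
    {x | I.IsFeasible x ∧ ∀ j, (D : ℚ) * x j ∈ ratInt}.Finite := by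
  have hfin : (Fintype.piFinset fun j => Finset.Icc ((D : ℤ) * I.l j) (D * I.u j) :
      Set (Fin z ⊕ Fin q → ℤ)).Finite := Finset.finite_toSet _
  refine (hfin.image fun t j => (t j : ℚ) / D).subset ?_
  rintro x ⟨⟨-, hb, -⟩, hx⟩
  have hD' : (0 : ℚ) < D := by exact_mod_cast hD
  choose t ht using hx
  simp only [eq_intCast] at ht
  refine ⟨t, ?_, funext fun j => ?_⟩
  · rw [mem_coe, Fintype.mem_piFinset]
    intro j
    rw [Finset.mem_Icc]
    have h1 := mul_le_mul_of_nonneg_left (hb j).1 hD'.le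
    have h2 := mul_le_mul_of_nonneg_left (hb j).2 hD'.le
    rw [← ht] at h1 h2
    exact ⟨by exact_mod_cast h1, by exact_mod_cast h2⟩
  · simp only [ht]
    field_simp

/-- Every feasible point is dominated by one in the finite set of feasible points with common
denominator `D`, so a minimizer over that set is optimal. -/
theorem exists_isOptimal_vecFr_le {h : ℕ} (hT : PrimalTdLE I.A h ∨ PrimalTdLE I.A.transpose h)
    (hI : ∃ x, I.IsFeasible x) :
    ∃ x, I.IsOptimal x ∧ vecFr x ≤ denomBound (maxCoeff I.A) h := by
  set D := denomBound (maxCoeff I.A) h with hDdef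
  have hD : 0 < D := denomBound_pos _ _
  have hbasic : ∀ x, I.IsFeasible x → ∃ y ∈ {x | I.IsFeasible x ∧ ∀ j, (D : ℚ) * x j ∈ ratInt},
      I.objective y ≤ I.objective x := by
    intro x hx
    obtain ⟨y, hy, hyB, hyx⟩ := I.exists_basic_objective_le _ x rfl hx
    exact ⟨y, ⟨hy, hyB.denomBound_mul_mem_ratInt hT hy⟩, hyx⟩
  obtain ⟨x₀, hx₀⟩ := hI
  obtain ⟨y₀, hy₀, -⟩ := hbasic x₀ hx₀
  obtain ⟨x, hx, hmin⟩ := Set.exists_min_image _ I.objective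
    (I.finite_feasible_bounded_denominator hD) ⟨y₀, hy₀⟩
  refine ⟨x, ⟨hx.1, fun y hy => ?_⟩, Finset.sup_le fun j _ => den_le_of_mul_mem_ratInt hD (hx.2 j)⟩
  obtain ⟨w, hw, hwy⟩ := hbasic y hy
  exact (hmin w hw).trans hwy

end MILP

/-! ### Computability of the bound -/

theorem primrec_factorial : Primrec Nat.factorial := by
  have h : Primrec₂ fun (n r : ℕ) => (n + 1) * r :=
    Primrec.nat_mul.comp (Primrec.succ.comp Primrec.fst) Primrec.snd
  refine (Primrec.nat_rec₁ 1 h).of_eq fun n => ?_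
  induction n with
  | zero => rfl
  | succ n ih => rw [Nat.factorial_succ, ← ih]

theorem primrec_pow : Primrec₂ fun a n : ℕ => a ^ n := by
  have h : Primrec₂ fun (a : ℕ) (p : ℕ × ℕ) => p.2 * a :=
    Primrec.nat_mul.comp (Primrec.snd.comp Primrec.snd) Primrec.fst
  refine (Primrec.nat_rec (Primrec.const 1) h).of_eq fun a n => ?_
  induction n with
  | zero => rfl
  | succ n ih => rw [pow_succ, ← ih]

theorem computable_denomBound : Computable₂ denomBound := by
  have h2 : Primrec fun p : ℕ × ℕ => 2 ^ (p.2 + 1) :=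
    primrec_pow.comp (Primrec.const 2) (Primrec.succ.comp Primrec.snd)
  have h3 : Primrec fun p : ℕ × ℕ => detMultiple p.1 (2 ^ (p.2 + 1)) :=
    primrec_factorial.comp (Primrec.nat_mul.comp (primrec_factorial.comp h2)
      (primrec_pow.comp (Primrec.succ.comp Primrec.fst) h2))
  exact (primrec_pow.comp h3 Primrec.snd).to_comp

end TDMILP

theorem theorem2 :
    (∃ f : ℕ → ℕ → ℕ, Computable₂ f ∧
      ∀ (m n : ℕ) (A : Matrix (Fin m) (Fin n) ℤ)
        (T : Type) [Fintype T] (F : TDMILP.RootedForest T),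
        F.IsTdDecomposition (TDMILP.primalGraph A) →
        ∀ B : Fin m ↪ Fin n,
          IsUnit ((A.submatrix id B).map (Int.cast : ℤ → ℚ)) →
          TDMILP.fr ((A.submatrix id B).map (Int.cast : ℤ → ℚ))⁻¹
            ≤ f (TDMILP.maxCoeff A) F.height) ∧
    (∃ g : ℕ → ℕ → ℕ, Computable₂ g ∧
      ∀ (m z q : ℕ) (I : TDMILP.MILP m z q),
        (∃ x, I.IsFeasible x) →
        ∃ x, I.IsOptimal x ∧
          TDMILP.vecFr x ≤ g (TDMILP.maxCoeff I.A)
            (min (TDMILP.treedepth (TDMILP.primalGraph I.A))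
              (TDMILP.treedepth (TDMILP.dualGraph I.A)))) := by
  refine ⟨⟨TDMILP.denomBound, TDMILP.computable_denomBound, ?_⟩,
    ⟨TDMILP.denomBound, TDMILP.computable_denomBound, ?_⟩⟩
  · intro m n A T _ F hF B hB
    refine Finset.sup_le fun p _ => TDMILP.den_le_of_mul_mem_ratInt (TDMILP.denomBound_pos _ _) ?_
    exact (hF.primalTdLE.submatrix id B B.injective).denomBound_mul_inv
      (fun k j => TDMILP.natAbs_le_maxCoeff A k (B j))
      ((Matrix.isUnit_iff_isUnit_det _).1 hB).ne_zero _ _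
  · intro m z q I hI
    refine I.exists_isOptimal_vecFr_le ?_ hI
    rcases min_choice (TDMILP.treedepth (TDMILP.primalGraph I.A))
      (TDMILP.treedepth (TDMILP.dualGraph I.A)) with h | h
    · exact Or.inl (h.symm ▸ TDMILP.primalTdLE_treedepth I.A)
    · exact Or.inr (h.symm ▸ TDMILP.primalTdLE_treedepth I.A.transpose)
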